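/- **Setting.** A rule uses the following names: *rank classes*; *aggregated axes*, each in exactly one rank class; map variables and symbolic reduction indices, each belonging to a rank class; and input tensors, each with an element type (integers, Booleans, reals), a set of aggregated axes and a symbolic size map on each of them. Map expressions are built from the map variables of one class by element-wise functions $\mathsf{fmap}(f,m_1,\dots,m_n)$ (constant maps for $n=0$). Tensor expressions are built from literals (all of whose axes are singletons) and input tensors by the operators const, iota, expand, element-wise binary operators, low/high/interior padding, slice, dynamic slice, dynamic update slice, reduce, relabel, concat, dot, convolution, select and reverse (and the derived clamp, low padding and dilated/padded convolution). A rewrite rule $R=(\mathsf{LHS}\Rightarrow_C\mathsf{RHS})$ has two expressions of the same element type and a precondition $C$ that is a conjunction of formulas built with $\wedge,\vee$ from folds $\mathsf{fold}(g,m_1,\dots,m_n)$, i.e. "$g$ holds of $m_1,\dots,m_n$ at every named axis" ($g$ any predicate on $\mathbb Z^n$). A rule with reductions also carries a hint, a conjunction of folds over map variables and symbolic reduction indices, which relates the reduction indices of the two sides (indices of the same name are identified). **Instances and validity.** Let $m$ assign a rank $m(c)\in\mathbb N$ to every rank class $c$. At ranks $m$ every aggregated axis of class $c$ stands for $m(c)$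 named axes, those of different aggregated axes of one class being identified by a canonical bijection; map variables and reduction indices of class $c$ are functions from these $m(c)$ named axes to $\mathbb Z$; an access assigns an index to every named axis of a tensor, and it is valid if every index is at least $0$ and less than the size. All operators have their usual pointwise semantics with side conditions; the conjunction of the side conditions is $\mathsf{valid\mbox{-}expr}$. Iota and concat require their distinguished aggregated axis to be a singleton (rank $1$). Reductions with operator $\oplus$ are not expanded: the element is $\mathsf{Red}^{\oplus}$ of the body evaluated at the symbolic reduction indices, with the rules $v\cdot\mathsf{Red}^{+}f=\mathsf{Red}^{+}f\cdot v=\mathsf{Red}^{+}(v\cdot f)$ (with the factors kept in their order), $\mathsf{Red}^{+}f\cdot\mathsf{Red}^{+}g=\mathsf{Red}^{+}(f\cdot g)$, $\mathsf{Red}^{\oplus}\mathsf{Red}^{\oplus}f=\mathsf{Red}^{\oplus}f$; any other operation on such elements is an error. $\mathsf{valid}(m)$ means: for every valuation of the map variables and input tensors at ranks $m$ that satisfies $C$ and $\mathsf{valid\mbox{-}expr}(\mathsf{LHS})$, (a) $\mathsf{valid\mbox{-}expr}(\mathsf{RHS})$ holds; (b) both sides have the same aggregated axes and sizes; (c) the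 hint is a one-to-one correspondence between the in-range values of the reduction indices of the left side and those of the right side; (d) at every valid access, both sides have the same, non-error element: scalars directly, and $\mathsf{Red}$ elements with the same operator and with equal bodies at all related in-range reduction indices. **The bound.** Evaluate both sides of $R$ symbolically at a general access, following all branches. This yields *conditions* (from padding, dynamic update slice and concat), each a conjunction over the aggregated axes of folds of a predicate, and *accesses* to input tensors, each a family of index transformers, one for each aggregated axis of the tensor; predicates and transformers do not depend on ranks and are functions of the map variables, general access and reduction indices of the class of their axis. Two conditions, or two accesses, are distinct if they are different as such families of functions. Let $\mathrm{NumConds}(R,c)$ be the number of distinct conditions whose predicate on some aggregated axis of class $c$ is non-trivial (not true on all integer inputs), $n_t$ the number of distinct accesses to the input tensor $t$, and $$\mathrm{InferBound}(R,c)=\max\Bigl(1,\ \mathrm{NumConds}(R,c)+\sum_{t}\binom{n_t}{2}\Bigr),$$ the sum being over the input tensors $t$ accessed in $R$ that have an aggregated axis of class $c$. **Statement.** Let $R$ be any rewrite rule of this language, $c$ a rank class, $m$ any map from rank classes to ranks, and $k=\mathrm{InferBound}(R,c)$. For every $i\ge k$ such that $m[c\mapsto i+1]$ is a valid instantiation of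 $R$ (it gives rank $1$ to every aggregated axis that an iota, a concat or a literal of $R$ uses as a singleton), $$\mathsf{valid}(m[c\mapsto i])\ \longrightarrow\ \mathsf{valid}(m[c\mapsto i+1]).$$ -/

import Mathlib

namespace TensorDSL

/-! ### Scalars -/

/-- Element types of tensors. -/
inductive DType
  | int
  | bool
  | real

/-- The scalars of an element type. -/
def DType.Carrier : DType → Type
  | .int => ℤ
  | .bool => Bool
  | .real => ℝ

/-- Element types with arithmetic. -/
inductive NumType
  | int
  | real

def NumType.dtype : NumType → DType
  | .int => .int
  | .real => .real

def NumType.zero : (ν : NumType) → ν.dtype.Carrier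
  | .int => (0 : ℤ)
  | .real => (0 : ℝ)

noncomputable def NumType.add : (ν : NumType) → ν.dtype.Carrier → ν.dtype.Carrier → ν.dtype.Carrier
  | .int => fun (a b : ℤ) => a + b
  | .real => fun (a b : ℝ) => a + b

noncomputable def NumType.mul : (ν : NumType) → ν.dtype.Carrier → ν.dtype.Carrier → ν.dtype.Carrier
  | .int => fun (a b : ℤ) => a * b
  | .real => fun (a b : ℝ) => a * b

noncomputable def NumType.min : (ν : NumType) → ν.dtype.Carrier → ν.dtype.Carrier → ν.dtype.Carrier
  | .int => fun (a b : ℤ) => @Min.min ℤ _ a b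
  | .real => fun (a b : ℝ) => @Min.min ℝ _ a b

noncomputable def NumType.max : (ν : NumType) → ν.dtype.Carrier → ν.dtype.Carrier → ν.dtype.Carrier
  | .int => fun (a b : ℤ) => @Max.max ℤ _ a b
  | .real => fun (a b : ℝ) => @Max.max ℝ _ a b

/-- Scalar binary operators: any function; multiplication is singled out because it is the only
operator that has rules on reduction elements. -/
inductive BinOp : DType → DType → DType → Type
  | mul (ν : NumType) : BinOp ν.dtype ν.dtype ν.dtype
  | fn {α β γ : DType} (f : α.Carrier → β.Carrier → γ.Carrier) : BinOp α β γ

/-! ### Tensor elements -/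

/-- A tensor element: a scalar; a reduction element `Red^op`, whose body `a` is the reduced value at
the current values of the symbolic reduction indices (the reduction is never expanded); or `err`,
the result of an operation on reduction elements for which there is no rule. -/
inductive Elem (α : Type)
  | val (a : α)
  | red (op : α → α → α) (a : α)
  | err

def Elem.IsScalar {α : Type} : Elem α → Prop
  | .val _ => True
  | _ => False

open Classical in
/-- Multiplication, with `v * Red⁺ f = Red⁺ (v * f)` and `Red⁺ f * Red⁺ g = Red⁺ (f * g)`. -/
noncomputable def Elem.mul (ν : NumType) :
    Elem ν.dtype.Carrier → Elem ν.dtype.Carrier → Elem ν.dtype.Carrier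
  | .val a, .val b => .val (ν.mul a b)
  | .val a, .red op b => if op = ν.add then .red op (ν.mul a b) else .err
  | .red op a, .val b => if op = ν.add then .red op (ν.mul a b) else .err
  | .red op a, .red op' b => if op = ν.add ∧ op' = ν.add then .red op (ν.mul a b) else .err
  | _, _ => .err

/-- A scalar binary operator on tensor elements. -/
noncomputable def BinOp.lift {α β γ : DType} :
    BinOp α β γ → Elem α.Carrier → Elem β.Carrier → Elem γ.Carrier
  | .mul ν, a, b => Elem.mul ν a b
  | .fn f, .val a, .val b => .val (f a b)
  | .fn _, _, _ => .err

open Classical in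
/-- Reduction, with `Red^op (Red^op f) = Red^op f` over the joint indices. -/
noncomputable def Elem.reduce {α : Type} (op : α → α → α) : Elem α → Elem α
  | .val a => .red op a
  | .red op' a => if op' = op then .red op a else .err
  | .err => .err

open Classical in
/-- `if p then a else b` for an element `p` of Boolean type. -/
noncomputable def Elem.select {α : Type} (p : Elem DType.bool.Carrier) (a b : Elem α) : Elem α :=
  match p with
  | .val t => if t = (true : Bool) then a else b
  | _ => .err

/-! ### Maps, folds, preconditions -/

/-- Expressions for maps (from named axes to integers) over map variables `V`: variables and
element-wise combinations `fmap(f, m₁, …, mₙ)`; for `n = 0` this is a constant map. -/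
inductive MapExpr (V : Type)
  | var (v : V)
  | fmap {n : ℕ} (f : (Fin n → ℤ) → ℤ) (args : Fin n → MapExpr V)

namespace MapExpr

/-- The value of a map at one named axis, given the values `ρ` of the variables at that axis. -/
def eval {V : Type} (ρ : V → ℤ) : MapExpr V → ℤ
  | .var v => ρ v
  | .fmap f args => f (fun k => (args k).eval ρ)

def const {V : Type} (z : ℤ) : MapExpr V := .fmap (n := 0) (fun _ => z) Fin.elim0

def map₁ {V : Type} (f : ℤ → ℤ) (a : MapExpr V) : MapExpr V :=
  .fmap (n := 1) (fun z => f (z 0)) ![a]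

def map₂ {V : Type} (f : ℤ → ℤ → ℤ) (a b : MapExpr V) : MapExpr V :=
  .fmap (n := 2) (fun z => f (z 0) (z 1)) ![a, b]

def map₃ {V : Type} (f : ℤ → ℤ → ℤ → ℤ) (a b c : MapExpr V) : MapExpr V :=
  .fmap (n := 3) (fun z => f (z 0) (z 1) (z 2)) ![a, b, c]

def map₄ {V : Type} (f : ℤ → ℤ → ℤ → ℤ → ℤ) (a b c d : MapExpr V) : MapExpr V :=
  .fmap (n := 4) (fun z => f (z 0) (z 1) (z 2) (z 3)) ![a, b, c, d]

end MapExpr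

/-- The names a rule uses: rank classes, and for each rank class its aggregated axes (so every
aggregated axis is in exactly one class), its map variables (operator attributes, sizes), and its
symbolic reduction indices. -/
structure AxisSig where
  Cls : Type
  Ax : Cls → Type
  Attr : Cls → Type
  Ix : Cls → Type

/-- Aggregated axes, tagged with their rank class. -/
abbrev AxisSig.Axis (S : AxisSig) : Type := Σ c : S.Cls, S.Ax c

/-- Symbolic aggregated maps: a domain of aggregated axes and a map on each axis of the domain
(values outside the domain are irrelevant). -/
structure AggMap (S : AxisSig) where
  dom : Set S.Axis
  map : ∀ c, S.Ax c → MapExpr (S.Attr c)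

/-- Aggregated maps of symbolic reduction indices. -/
structure IdxMap (S : AxisSig) where
  dom : Set S.Axis
  name : ∀ c, S.Ax c → S.Ix c

/-- The names of a rule together with its input tensors and their declared symbolic shapes. -/
structure Sig extends AxisSig where
  Ten : Type
  dtype : Ten → DType
  shape : Ten → AggMap toAxisSig

/-- `fold(g, m₁, …, mₙ)` over the named axes of class `cls`, with map variables `V`. -/
structure Fold {C : Type} (V : C → Type) where
  cls : C
  n : ℕ
  g : (Fin n → ℤ) → Prop
  args : Fin n → MapExpr (V cls)

/-- Values of map variables at ranks `m`: the named axes of an aggregated axis of class `c` are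
`Fin (m c)`, and the canonical bijections between the axes of one class are identities. -/
abbrev MapVal {C : Type} (V : C → Type) (m : C → ℕ) : Type := ∀ c, V c → Fin (m c) → ℤ

def Fold.Holds {C : Type} {V : C → Type} (F : Fold V) {m : C → ℕ} (val : MapVal V m) : Prop :=
  ∀ j : Fin (m F.cls), F.g (fun k => (F.args k).eval (fun u => val F.cls u j))

/-- Preconditions: built from folds by conjunction and disjunction. -/
inductive Precond {C : Type} (V : C → Type)
  | fold (F : Fold V)
  | and (P Q : Precond V)
  | or (P Q : Precond V)

def Precond.Holds {C : Type} {V : C → Type} {m : C → ℕ} (val : MapVal V m) : Precond V → Prop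
  | .fold F => F.Holds val
  | .and P Q => P.Holds val ∧ Q.Holds val
  | .or P Q => P.Holds val ∨ Q.Holds val

/-! ### Tensor expressions -/

/-- Tensor expressions. -/
inductive Expr (S : Sig) : DType → Type
  /-- a literal tensor: all its axes are singletons -/
  | lit {τ} (dom : Set S.Axis) (size : ∀ c, S.Ax c → ℕ) (data : (∀ c, S.Ax c → ℤ) → τ.Carrier) :
      Expr S τ
  | var (t : S.Ten) : Expr S (S.dtype t)
  | const {τ} (a : τ.Carrier) (M : AggMap S.toAxisSig) : Expr S τ
  | iota (M : AggMap S.toAxisSig) (x : S.Axis) : Expr S .int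
  | expand {τ} (e : Expr S τ) (M : AggMap S.toAxisSig) : Expr S τ
  | binary {α β γ} (o : BinOp α β γ) (e : Expr S α) (e' : Expr S β) : Expr S γ
  /-- low, high and interior padding with the value `a` -/
  | pad {τ} (e : Expr S τ) (a : τ.Carrier) (Sl Sh Si : AggMap S.toAxisSig) : Expr S τ
  /-- start, end, stride -/
  | slice {τ} (e : Expr S τ) (Is Ie Ip : AggMap S.toAxisSig) : Expr S τ
  | dySlice {τ} (e : Expr S τ) (I M : AggMap S.toAxisSig) : Expr S τ
  | dyupSlice {τ} (e eu : Expr S τ) (I : AggMap S.toAxisSig) : Expr S τ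
  | reduce {τ} (op : τ.Carrier → τ.Carrier → τ.Carrier) (e : Expr S τ) (I : IdxMap S.toAxisSig) :
      Expr S τ
  | relabel {τ} (e : Expr S τ) (R : ∀ c, S.Ax c → S.Ax c) : Expr S τ
  | concat {τ} (e e' : Expr S τ) (x : S.Axis) : Expr S τ
  /-- contraction over the axes `I.dom`, with batch axes `Xb` -/
  | dot (ν : NumType) (e₁ e₂ : Expr S ν.dtype) (I : IdxMap S.toAxisSig) (Xb : Set S.Axis) :
      Expr S ν.dtype
  /-- convolution with batch, input-feature and output-feature axes `Xb`, `Xf`, `Xo` and strides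
  `Ip`; `I` holds the symbolic reduction indices -/
  | convBase (ν : NumType) (ei ew : Expr S ν.dtype) (Xb Xf Xo : Set S.Axis)
      (Ip : AggMap S.toAxisSig) (I : IdxMap S.toAxisSig) : Expr S ν.dtype
  | select {τ} (eb : Expr S .bool) (e₁ e₂ : Expr S τ) : Expr S τ
  | reverse {τ} (e : Expr S τ) (X : Set S.Axis) : Expr S τ

/-- Number of interior-padded cells: `s + (s - 1) * i`. -/
def padInner (s si : ℤ) : ℤ := s + (s - 1) * si

/-- The index `a` along an axis of size `s` is not in the padded area. -/
def notPad (s sl si a : ℤ) : Prop :=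
  sl ≤ a ∧ a < padInner s si + sl ∧ (a - sl) % (si + 1) = 0

/-- Output size of a slice: `⌈(e - s) / p⌉` for `p > 0`. -/
def sliceSize (s e p : ℤ) : ℤ := -(-(e - s) / p)

/-- Output size of a convolution along a spatial axis: `⌊(si - sw) / p + 1⌋` for `p > 0`. -/
def convSize (si sw p : ℤ) : ℤ := (si - sw) / p + 1

/-- The spatial axes of a convolution. -/
def spatial {S : AxisSig} (Xi Xb Xf : Set S.Axis) : Set S.Axis := Xi \ (Xb ∪ Xf)

namespace Expr

variable {S : Sig}

open Classical in
/-- The symbolic shape of an expression. -/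
noncomputable def shape : {τ : DType} → Expr S τ → AggMap S.toAxisSig
  | _, .lit dom size _ => ⟨dom, fun c x => .const (size c x)⟩
  | _, .var t => S.shape t
  | _, .const _ M => M
  | _, .iota M _ => M
  | _, .expand e M =>
      ⟨e.shape.dom ∪ M.dom, fun c x => if ⟨c, x⟩ ∈ M.dom then M.map c x else e.shape.map c x⟩
  | _, .binary _ e _ => e.shape
  | _, .pad e _ Sl Sh Si =>
      ⟨e.shape.dom, fun c x => .map₄ (fun s sl sh si => padInner s si + sl + sh)
        (e.shape.map c x) (Sl.map c x) (Sh.map c x) (Si.map c x)⟩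
  | _, .slice e Is Ie Ip =>
      ⟨e.shape.dom, fun c x => .map₃ sliceSize (Is.map c x) (Ie.map c x) (Ip.map c x)⟩
  | _, .dySlice _ _ M => M
  | _, .dyupSlice e _ _ => e.shape
  | _, .reduce _ e I => ⟨e.shape.dom \ I.dom, e.shape.map⟩
  | _, .relabel e R =>
      ⟨{y | ∃ x, (⟨y.1, x⟩ : S.Axis) ∈ e.shape.dom ∧ R y.1 x = y.2}, fun c y =>
        if h : ∃ x, (⟨c, x⟩ : S.Axis) ∈ e.shape.dom ∧ R c x = y then e.shape.map c h.choose
        else .const 0⟩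
  | _, .concat e e' x₀ =>
      ⟨e.shape.dom, fun c x =>
        if (⟨c, x⟩ : S.Axis) = x₀ then .map₂ (· + ·) (e.shape.map c x) (e'.shape.map c x)
        else e.shape.map c x⟩
  | _, .dot _ e₁ e₂ I _ =>
      ⟨(e₁.shape.dom ∪ e₂.shape.dom) \ I.dom, fun c x =>
        if ⟨c, x⟩ ∈ e₁.shape.dom then e₁.shape.map c x else e₂.shape.map c x⟩
  | _, .convBase _ ei ew Xb Xf Xo Ip _ =>
      ⟨Xb ∪ Xo ∪ spatial ei.shape.dom Xb Xf, fun c x =>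
        if ⟨c, x⟩ ∈ Xb then ei.shape.map c x
        else if ⟨c, x⟩ ∈ Xo then ew.shape.map c x
        else .map₃ convSize (ei.shape.map c x) (ew.shape.map c x) (Ip.map c x)⟩
  | _, .select _ e₁ _ => e₁.shape
  | _, .reverse e _ => e.shape

end Expr

/-! ### Instances at concrete ranks -/

/-- An access at ranks `m`: an index for every named axis of every aggregated axis; only the
components at the axes of the accessed tensor are ever used. -/
abbrev Acc (S : AxisSig) (m : S.Cls → ℕ) : Type := MapVal S.Ax m

/-- A valuation of the variables of a rule at ranks `m`: the map variables, and for every input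
tensor its elements as a function of the accesses on its own axes (it is only ever read at
valid accesses by a valid expression). -/
structure Valuation (S : Sig) (m : S.Cls → ℕ) where
  attr : MapVal S.Attr m
  ten : ∀ t : S.Ten,
    (∀ (c : S.Cls) (x : S.Ax c), (⟨c, x⟩ : S.Axis) ∈ (S.shape t).dom → Fin (m c) → ℤ) →
      (S.dtype t).Carrier

/-- The value of an aggregated map at a named axis. -/
def AggMap.at {S : AxisSig} (M : AggMap S) {m : S.Cls → ℕ} (val : MapVal S.Attr m)
    (c : S.Cls) (x : S.Ax c) (j : Fin (m c)) : ℤ :=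
  (M.map c x).eval (fun u => val c u j)

/-- A property holds at all named axes of all aggregated axes in `X`. -/
def AllAx {S : AxisSig} (m : S.Cls → ℕ) (X : Set S.Axis)
    (P : ∀ (c : S.Cls), S.Ax c → Fin (m c) → Prop) : Prop :=
  ∀ (c : S.Cls) (x : S.Ax c), (⟨c, x⟩ : S.Axis) ∈ X → ∀ j : Fin (m c), P c x j

/-- `A` is a valid access for the shape `M`. -/
def AggMap.IsAccess {S : AxisSig} (M : AggMap S) {m : S.Cls → ℕ} (val : MapVal S.Attr m)
    (A : Acc S m) : Prop :=
  AllAx m M.dom fun c x j => 0 ≤ A c x j ∧ A c x j < M.at val c x j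

/-- Two shapes are equal: same aggregated axes, same sizes. -/
def AggMap.Same {S : AxisSig} (M N : AggMap S) {m : S.Cls → ℕ} (val : MapVal S.Attr m) : Prop :=
  M.dom = N.dom ∧ AllAx m M.dom fun c x j => M.at val c x j = N.at val c x j

open Classical in
/-- The index at the only named axis of each singleton axis in `X`, and `0` elsewhere. -/
noncomputable def Acc.single {S : AxisSig} {m : S.Cls → ℕ} (A : Acc S m) (X : Set S.Axis)
    (c : S.Cls) (x : S.Ax c) : ℤ :=
  if h : (⟨c, x⟩ : S.Axis) ∈ X ∧ 0 < m c then A c x ⟨0, h.2⟩ else 0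

open Classical in
/-- `A` with the components at `I.dom` replaced by the symbolic reduction indices. -/
noncomputable def Acc.subst {S : AxisSig} {m : S.Cls → ℕ} (A : Acc S m) (I : IdxMap S)
    (σ : MapVal S.Ix m) : Acc S m :=
  fun c x j => if (⟨c, x⟩ : S.Axis) ∈ I.dom then σ c (I.name c x) j else A c x j

namespace Expr

variable {S : Sig} {m : S.Cls → ℕ}

/-- `valid-expr`: the premises of the semantic rules of all operators in the expression. -/
def Valid (v : Valuation S m) : {τ : DType} → Expr S τ → Prop
  | _, .lit dom _ _ => ∀ x ∈ dom, m x.1 = 1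
  | _, .var t => AllAx m (S.shape t).dom fun c x j => 0 ≤ (S.shape t).at v.attr c x j
  | _, .const _ M => AllAx m M.dom fun c x j => 0 ≤ M.at v.attr c x j
  | _, .iota M x₀ =>
      (AllAx m M.dom fun c x j => 0 ≤ M.at v.attr c x j) ∧ x₀ ∈ M.dom ∧ m x₀.1 = 1
  | _, .expand e M => e.Valid v ∧ (AllAx m M.dom fun c x j => 0 ≤ M.at v.attr c x j) ∧
      Disjoint M.dom e.shape.dom
  | _, .binary _ e e' => e.Valid v ∧ e'.Valid v ∧ e.shape.Same e'.shape v.attr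
  | _, .pad e a Sl Sh Si => e.Valid v ∧
      Sl.dom = e.shape.dom ∧ Sh.dom = e.shape.dom ∧ Si.dom = e.shape.dom ∧
      AllAx m e.shape.dom fun c x j =>
        0 ≤ Si.at v.attr c x j ∧ 0 ≤ (pad e a Sl Sh Si).shape.at v.attr c x j
  | _, .slice e Is Ie Ip => e.Valid v ∧
      Is.dom = e.shape.dom ∧ Ie.dom = e.shape.dom ∧ Ip.dom = e.shape.dom ∧
      AllAx m e.shape.dom fun c x j =>
        0 ≤ Is.at v.attr c x j ∧ Is.at v.attr c x j ≤ Ie.at v.attr c x j ∧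
        Ie.at v.attr c x j ≤ e.shape.at v.attr c x j ∧ 0 < Ip.at v.attr c x j
  | _, .dySlice e I M => e.Valid v ∧ I.dom = e.shape.dom ∧ M.dom = e.shape.dom ∧
      AllAx m e.shape.dom fun c x j =>
        I.at v.attr c x j + M.at v.attr c x j ≤ e.shape.at v.attr c x j ∧
        0 < M.at v.attr c x j ∧ 0 ≤ I.at v.attr c x j
  | _, .dyupSlice e eu I => e.Valid v ∧ eu.Valid v ∧
      I.dom = e.shape.dom ∧ eu.shape.dom = e.shape.dom ∧
      AllAx m e.shape.dom fun c x j =>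
        I.at v.attr c x j + eu.shape.at v.attr c x j ≤ e.shape.at v.attr c x j ∧
        0 < eu.shape.at v.attr c x j ∧ 0 ≤ I.at v.attr c x j
  | _, .reduce _ e I => e.Valid v ∧ I.dom ⊆ e.shape.dom
  | _, .relabel e R => e.Valid v ∧
      ∀ (c : S.Cls) (x x' : S.Ax c), (⟨c, x⟩ : S.Axis) ∈ e.shape.dom →
        (⟨c, x'⟩ : S.Axis) ∈ e.shape.dom → x ≠ x' → R c x ≠ R c x'
  | _, .concat e e' x₀ => e.Valid v ∧ e'.Valid v ∧ m x₀.1 = 1 ∧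
      x₀ ∈ e.shape.dom ∧ e'.shape.dom = e.shape.dom ∧
      AllAx m (e.shape.dom \ {x₀}) fun c x j =>
        e.shape.at v.attr c x j = e'.shape.at v.attr c x j
  | _, .dot _ e₁ e₂ I Xb => e₁.Valid v ∧ e₂.Valid v ∧
      I.dom ∪ Xb = e₁.shape.dom ∩ e₂.shape.dom ∧ Disjoint I.dom Xb ∧
      AllAx m (I.dom ∪ Xb) fun c x j => e₁.shape.at v.attr c x j = e₂.shape.at v.attr c x j
  | _, .convBase ν ei ew Xb Xf Xo Ip I => ei.Valid v ∧ ew.Valid v ∧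
      Xb = ei.shape.dom \ ew.shape.dom ∧ Xo = ew.shape.dom \ ei.shape.dom ∧
      Xf ⊆ ei.shape.dom ∩ ew.shape.dom ∧ Ip.dom = spatial ei.shape.dom Xb Xf ∧
      I.dom = Xf ∪ spatial ei.shape.dom Xb Xf ∧
      (AllAx m Xf fun c x j => ei.shape.at v.attr c x j = ew.shape.at v.attr c x j) ∧
      AllAx m (spatial ei.shape.dom Xb Xf) fun c x j => 0 < Ip.at v.attr c x j ∧
        0 ≤ (convBase ν ei ew Xb Xf Xo Ip I).shape.at v.attr c x j
  | _, .select eb e₁ e₂ => eb.Valid v ∧ e₁.Valid v ∧ e₂.Valid v ∧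
      eb.shape.Same e₁.shape v.attr ∧ e₁.shape.Same e₂.shape v.attr
  | _, .reverse e X => e.Valid v ∧ X ⊆ e.shape.dom

open Classical in
/-- Denotation: the tensor element at an access, for the values `σ` of the symbolic reduction
indices. -/
noncomputable def eval (v : Valuation S m) (σ : MapVal S.Ix m) :
    {τ : DType} → Expr S τ → Acc S.toAxisSig m → Elem τ.Carrier
  | _, .lit dom _ data, A => .val (data (A.single dom))
  | _, .var t, A => .val (v.ten t (fun c x _ => A c x))
  | _, .const a _, _ => .val a
  | _, .iota _ x₀, A => .val (A.single {x₀} x₀.1 x₀.2 : ℤ)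
  | _, .expand e _, A => e.eval v σ A
  | _, .binary o e e', A => o.lift (e.eval v σ A) (e'.eval v σ A)
  | _, .pad e a Sl _ Si, A =>
      if AllAx m e.shape.dom fun c x j =>
        notPad (e.shape.at v.attr c x j) (Sl.at v.attr c x j) (Si.at v.attr c x j) (A c x j)
      then e.eval v σ fun c x j => (A c x j - Sl.at v.attr c x j) / (Si.at v.attr c x j + 1)
      else .val a
  | _, .slice e Is _ Ip, A =>
      e.eval v σ fun c x j => Is.at v.attr c x j + A c x j * Ip.at v.attr c x j
  | _, .dySlice e I _, A => e.eval v σ fun c x j => A c x j + I.at v.attr c x j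
  | _, .dyupSlice e eu I, A =>
      if AllAx m e.shape.dom fun c x j => I.at v.attr c x j ≤ A c x j ∧
        A c x j < I.at v.attr c x j + eu.shape.at v.attr c x j
      then eu.eval v σ fun c x j => A c x j - I.at v.attr c x j
      else e.eval v σ A
  | _, .reduce op e I, A => (e.eval v σ (A.subst I σ)).reduce op
  | _, .relabel e R, A => e.eval v σ fun c x => A c (R c x)
  | _, .concat e e' x₀, A =>
      if AllAx m {x₀} fun c x j => e.shape.at v.attr c x j ≤ A c x j
      then e'.eval v σ fun c x j =>
        if (⟨c, x⟩ : S.Axis) = x₀ then A c x j - e.shape.at v.attr c x j else A c x j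
      else e.eval v σ A
  | _, .dot ν e₁ e₂ I _, A =>
      (Elem.mul ν (e₁.eval v σ (A.subst I σ)) (e₂.eval v σ (A.subst I σ))).reduce ν.add
  | _, .convBase ν ei ew Xb Xf _ Ip I, A =>
      (Elem.mul ν
        (ei.eval v σ fun c x j =>
          if (⟨c, x⟩ : S.Axis) ∈ spatial ei.shape.dom Xb Xf
          then A c x j * Ip.at v.attr c x j + A.subst I σ c x j else A.subst I σ c x j)
        (ew.eval v σ (A.subst I σ))).reduce ν.add
  | _, .select eb e₁ e₂, A => Elem.select (eb.eval v σ A) (e₁.eval v σ A) (e₂.eval v σ A)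
  | _, .reverse e X, A => e.eval v σ fun c x j =>
      if (⟨c, x⟩ : S.Axis) ∈ X then e.shape.at v.attr c x j - A c x j - 1 else A c x j

/-! ### Symbolic reduction indices and singleton axes -/

/-- The symbolic reduction indices of an expression, each with the size of the axis it runs over. -/
def bounds : {τ : DType} → Expr S τ → Set (Σ c : S.Cls, S.Ix c × MapExpr (S.Attr c))
  | _, .lit _ _ _ => ∅
  | _, .var _ => ∅
  | _, .const _ _ => ∅
  | _, .iota _ _ => ∅
  | _, .expand e _ => e.bounds
  | _, .binary _ e e' => e.bounds ∪ e'.bounds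
  | _, .pad e _ _ _ _ => e.bounds
  | _, .slice e _ _ _ => e.bounds
  | _, .dySlice e _ _ => e.bounds
  | _, .dyupSlice e eu _ => e.bounds ∪ eu.bounds
  | _, .reduce _ e I =>
      e.bounds ∪ {b | ∃ x ∈ I.dom, b = ⟨x.1, I.name x.1 x.2, e.shape.map x.1 x.2⟩}
  | _, .relabel e _ => e.bounds
  | _, .concat e e' _ => e.bounds ∪ e'.bounds
  | _, .dot _ e₁ e₂ I _ => e₁.bounds ∪ e₂.bounds ∪
      {b | ∃ x ∈ I.dom, b = ⟨x.1, I.name x.1 x.2, e₁.shape.map x.1 x.2⟩}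
  | _, .convBase _ ei ew _ _ _ _ I => ei.bounds ∪ ew.bounds ∪
      {b | ∃ x ∈ I.dom, b = ⟨x.1, I.name x.1 x.2, ew.shape.map x.1 x.2⟩}
  | _, .select eb e₁ e₂ => eb.bounds ∪ e₁.bounds ∪ e₂.bounds
  | _, .reverse e _ => e.bounds

/-- The values of the symbolic reduction indices are within the reduced axes. -/
def InRange {τ : DType} (e : Expr S τ) (v : Valuation S m) (σ : MapVal S.Ix m) : Prop :=
  ∀ (c : S.Cls) (i : S.Ix c) (b : MapExpr (S.Attr c)), ⟨c, i, b⟩ ∈ e.bounds →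
    ∀ j : Fin (m c), 0 ≤ σ c i j ∧ σ c i j < b.eval (fun u => v.attr c u j)

/-- Two valuations of the symbolic reduction indices agree on those of `e`. -/
def SameIdx {τ : DType} (e : Expr S τ) (σ σ' : MapVal S.Ix m) : Prop :=
  ∀ (c : S.Cls) (i : S.Ix c) (b : MapExpr (S.Attr c)), ⟨c, i, b⟩ ∈ e.bounds → σ c i = σ' c i

/-- The aggregated axes that the operators of an expression require to be singletons. -/
def singletons : {τ : DType} → Expr S τ → Set S.Axis
  | _, .lit dom _ _ => dom
  | _, .var _ => ∅
  | _, .const _ _ => ∅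
  | _, .iota _ x₀ => {x₀}
  | _, .expand e _ => e.singletons
  | _, .binary _ e e' => e.singletons ∪ e'.singletons
  | _, .pad e _ _ _ _ => e.singletons
  | _, .slice e _ _ _ => e.singletons
  | _, .dySlice e _ _ => e.singletons
  | _, .dyupSlice e eu _ => e.singletons ∪ eu.singletons
  | _, .reduce _ e _ => e.singletons
  | _, .relabel e _ => e.singletons
  | _, .concat e e' x₀ => e.singletons ∪ e'.singletons ∪ {x₀}
  | _, .dot _ e₁ e₂ _ _ => e₁.singletons ∪ e₂.singletons
  | _, .convBase _ ei ew _ _ _ _ _ => ei.singletons ∪ ew.singletons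
  | _, .select eb e₁ e₂ => eb.singletons ∪ e₁.singletons ∪ e₂.singletons
  | _, .reverse e _ => e.singletons

end Expr

/-! ### Symbolic evaluation under a general access -/

/-- The symbolic maps of class `c` in a rule evaluated under a general access: the map variables,
the general access at each axis, and the symbolic reduction indices. -/
inductive LVar (S : AxisSig) (c : S.Cls)
  | attr (u : S.Attr c)
  | acc (x : S.Ax c)
  | si (i : S.Ix c)

/-- Values of all symbolic maps of class `c` at one named axis. -/
abbrev LEnv (S : AxisSig) (c : S.Cls) : Type := LVar S c → ℤ

/-- An index transformer for each aggregated axis: it is the same at all named axes of that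
aggregated axis and does not depend on ranks. -/
abbrev SymAcc (S : AxisSig) : Type := ∀ c, S.Ax c → LEnv S c → ℤ

/-- A condition: the conjunction over all aggregated axes of the fold of a predicate. -/
abbrev Cond (S : AxisSig) : Type := ∀ c, S.Ax c → LEnv S c → Prop

/-- Access expressions of the input tensor `t`: index transformers for the axes of `t`. -/
abbrev TenAcc (S : Sig) (t : S.Ten) : Type :=
  ∀ (c : S.Cls) (x : S.Ax c), (⟨c, x⟩ : S.Axis) ∈ (S.shape t).dom → LEnv S.toAxisSig c → ℤ

/-- The value of an aggregated map at a named axis, from the values of the symbolic maps there. -/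
def AggMap.loc {S : AxisSig} (M : AggMap S) (c : S.Cls) (x : S.Ax c) (ρ : LEnv S c) : ℤ :=
  (M.map c x).eval (fun u => ρ (.attr u))

open Classical in
/-- Replace the components at `I.dom` by the symbolic reduction indices. -/
noncomputable def SymAcc.subst {S : AxisSig} (a : SymAcc S) (I : IdxMap S) : SymAcc S :=
  fun c x ρ => if (⟨c, x⟩ : S.Axis) ∈ I.dom then ρ (.si (I.name c x)) else a c x ρ

/-- The general access. -/
def SymAcc.general (S : AxisSig) : SymAcc S := fun _ x ρ => ρ (.acc x)

namespace Expr

variable {S : Sig}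

/-! The symbolic accesses at which the operands of an operator are read when the operator itself is
read at the symbolic access `a`. -/

def padSym (Sl Si : AggMap S.toAxisSig) (a : SymAcc S.toAxisSig) : SymAcc S.toAxisSig :=
  fun c x ρ => (a c x ρ - Sl.loc c x ρ) / (Si.loc c x ρ + 1)

def sliceSym (Is Ip : AggMap S.toAxisSig) (a : SymAcc S.toAxisSig) : SymAcc S.toAxisSig :=
  fun c x ρ => Is.loc c x ρ + a c x ρ * Ip.loc c x ρ

def addSym (I : AggMap S.toAxisSig) (a : SymAcc S.toAxisSig) : SymAcc S.toAxisSig :=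
  fun c x ρ => a c x ρ + I.loc c x ρ

def subSym (I : AggMap S.toAxisSig) (a : SymAcc S.toAxisSig) : SymAcc S.toAxisSig :=
  fun c x ρ => a c x ρ - I.loc c x ρ

open Classical in
noncomputable def concatSym (M : AggMap S.toAxisSig) (x₀ : S.Axis) (a : SymAcc S.toAxisSig) :
    SymAcc S.toAxisSig :=
  fun c x ρ => if (⟨c, x⟩ : S.Axis) = x₀ then a c x ρ - M.loc c x ρ else a c x ρ

open Classical in
noncomputable def convSym (Xsp : Set S.Axis) (Ip : AggMap S.toAxisSig) (I : IdxMap S.toAxisSig)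
    (a : SymAcc S.toAxisSig) : SymAcc S.toAxisSig :=
  fun c x ρ => if (⟨c, x⟩ : S.Axis) ∈ Xsp then a c x ρ * Ip.loc c x ρ + a.subst I c x ρ
    else a.subst I c x ρ

open Classical in
noncomputable def reverseSym (M : AggMap S.toAxisSig) (X : Set S.Axis) (a : SymAcc S.toAxisSig) :
    SymAcc S.toAxisSig :=
  fun c x ρ => if (⟨c, x⟩ : S.Axis) ∈ X then M.loc c x ρ - a c x ρ - 1 else a c x ρ

/-- All conditions met in the symbolic evaluation of an expression at the symbolic access `a`. -/
noncomputable def conds : {τ : DType} → Expr S τ → SymAcc S.toAxisSig → List (Cond S.toAxisSig)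
  | _, .lit _ _ _, _ => []
  | _, .var _, _ => []
  | _, .const _ _, _ => []
  | _, .iota _ _, _ => []
  | _, .expand e _, a => e.conds a
  | _, .binary _ e e', a => e.conds a ++ e'.conds a
  | _, .pad e _ Sl _ Si, a =>
      (fun c x ρ => (⟨c, x⟩ : S.Axis) ∈ e.shape.dom →
        notPad (e.shape.loc c x ρ) (Sl.loc c x ρ) (Si.loc c x ρ) (a c x ρ)) ::
      e.conds (padSym Sl Si a)
  | _, .slice e Is _ Ip, a => e.conds (sliceSym Is Ip a)
  | _, .dySlice e I _, a => e.conds (addSym I a)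
  | _, .dyupSlice e eu I, a =>
      (fun c x ρ => (⟨c, x⟩ : S.Axis) ∈ e.shape.dom →
        I.loc c x ρ ≤ a c x ρ ∧ a c x ρ < I.loc c x ρ + eu.shape.loc c x ρ) ::
      (eu.conds (subSym I a) ++ e.conds a)
  | _, .reduce _ e I, a => e.conds (a.subst I)
  | _, .relabel e R, a => e.conds fun c x => a c (R c x)
  | _, .concat e e' x₀, a =>
      (fun c x ρ => (⟨c, x⟩ : S.Axis) = x₀ → e.shape.loc c x ρ ≤ a c x ρ) ::
      (e'.conds (concatSym e.shape x₀ a) ++ e.conds a)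
  | _, .dot _ e₁ e₂ I _, a => e₁.conds (a.subst I) ++ e₂.conds (a.subst I)
  | _, .convBase _ ei ew Xb Xf _ Ip I, a =>
      ei.conds (convSym (spatial ei.shape.dom Xb Xf) Ip I a) ++ ew.conds (a.subst I)
  | _, .select eb e₁ e₂, a => eb.conds a ++ e₁.conds a ++ e₂.conds a
  | _, .reverse e X, a => e.conds (reverseSym e.shape X a)

/-- All accesses to input tensors met in the symbolic evaluation of an expression at the symbolic
access `a`. -/
noncomputable def accesses : {τ : DType} → Expr S τ → SymAcc S.toAxisSig →
    List (Σ t : S.Ten, TenAcc S t)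
  | _, .lit _ _ _, _ => []
  | _, .var t, a => [⟨t, fun c x _ => a c x⟩]
  | _, .const _ _, _ => []
  | _, .iota _ _, _ => []
  | _, .expand e _, a => e.accesses a
  | _, .binary _ e e', a => e.accesses a ++ e'.accesses a
  | _, .pad e _ Sl _ Si, a => e.accesses (padSym Sl Si a)
  | _, .slice e Is _ Ip, a => e.accesses (sliceSym Is Ip a)
  | _, .dySlice e I _, a => e.accesses (addSym I a)
  | _, .dyupSlice e eu I, a => eu.accesses (subSym I a) ++ e.accesses a
  | _, .reduce _ e I, a => e.accesses (a.subst I)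
  | _, .relabel e R, a => e.accesses fun c x => a c (R c x)
  | _, .concat e e' x₀, a => e'.accesses (concatSym e.shape x₀ a) ++ e.accesses a
  | _, .dot _ e₁ e₂ I _, a => e₁.accesses (a.subst I) ++ e₂.accesses (a.subst I)
  | _, .convBase _ ei ew Xb Xf _ Ip I, a =>
      ei.accesses (convSym (spatial ei.shape.dom Xb Xf) Ip I a) ++ ew.accesses (a.subst I)
  | _, .select eb e₁ e₂, a => eb.accesses a ++ e₁.accesses a ++ e₂.accesses a
  | _, .reverse e X, a => e.accesses (reverseSym e.shape X a)

/-! ### Derived operators -/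

/-- `clamp(min, e, max)`. -/
noncomputable def clamp (ν : NumType) (emin e emax : Expr S ν.dtype) : Expr S ν.dtype :=
  .binary (.fn ν.min) (.binary (.fn ν.max) e emin) emax

/-- Low padding only. -/
noncomputable def padLow {τ : DType} (e : Expr S τ) (a : τ.Carrier) (Sl : AggMap S.toAxisSig) :
    Expr S τ :=
  .pad e a Sl ⟨e.shape.dom, fun _ _ => .const 0⟩ ⟨e.shape.dom, fun _ _ => .const 0⟩

/-- General convolution: low and high padding `Sl`, `Sh` of the input, dilations `Si`, `Si'` of the
input and the weights, strides `Ip`. -/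
noncomputable def conv (ν : NumType) (ei ew : Expr S ν.dtype) (Xb Xf Xo : Set S.Axis)
    (Sl Sh Si Si' Ip : AggMap S.toAxisSig) (I : IdxMap S.toAxisSig) : Expr S ν.dtype :=
  .convBase ν
    (.pad ei ν.zero Sl Sh ⟨Si.dom, fun c x => .map₁ (· - 1) (Si.map c x)⟩)
    (.pad ew ν.zero ⟨ew.shape.dom, fun _ _ => .const 0⟩ ⟨ew.shape.dom, fun _ _ => .const 0⟩
      ⟨Si'.dom, fun c x => .map₁ (· - 1) (Si'.map c x)⟩)
    Xb Xf Xo Ip I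

end Expr

/-! ### Rewrite rules -/

/-- A rewrite rule `lhs ⇒_pre rhs` over the names `S`. For rules with reductions, `hint` is the
user-supplied relation between the symbolic reduction indices of the two sides: a conjunction of
folds over map variables and reduction indices. Indices with the same name are identified. -/
structure Rule (S : Sig) where
  τ : DType
  lhs : Expr S τ
  rhs : Expr S τ
  pre : List (Precond S.Attr)
  hint : List (Fold fun c => S.Attr c ⊕ S.Ix c)

namespace Rule

variable {S : Sig} {m : S.Cls → ℕ}

/-- The rank map `m` is a valid instantiation of the rule: every aggregated axis that an operator
of the rule takes as a singleton has rank `1`. -/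
def Admissible (R : Rule S) (m : S.Cls → ℕ) : Prop :=
  ∀ x ∈ R.lhs.singletons ∪ R.rhs.singletons, m x.1 = 1

/-- The reduction indices of both sides are in range and related by the hint. -/
def Related (R : Rule S) (v : Valuation S m) (σ : MapVal S.Ix m) : Prop :=
  R.lhs.InRange v σ ∧ R.rhs.InRange v σ ∧
    ∀ F ∈ R.hint, F.Holds (m := m) fun c => Sum.elim (v.attr c) (σ c)

/-- The hint is a one-to-one correspondence between the values in range of the reduction indices of
the left-hand side and those of the right-hand side. -/
def IndexBijection (R : Rule S) (v : Valuation S m) : Prop :=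
  (∀ σ, R.lhs.InRange v σ → ∃ σ', R.Related v σ' ∧ R.lhs.SameIdx σ σ') ∧
  (∀ σ, R.rhs.InRange v σ → ∃ σ', R.Related v σ' ∧ R.rhs.SameIdx σ σ') ∧
  (∀ σ σ', R.Related v σ → R.Related v σ' → (R.lhs.SameIdx σ σ' ↔ R.rhs.SameIdx σ σ'))

/-- `valid(m)`: for all values of the variables that satisfy the preconditions and make the
left-hand side valid, the right-hand side is valid and both sides denote the same tensor: same
shape, and same element at every valid access. Scalars are compared directly; reduction elements are
compared at related reduction indices, where the hint has to be a bijection. -/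
def ValidAt (R : Rule S) (m : S.Cls → ℕ) : Prop :=
  ∀ v : Valuation S m, (∀ P ∈ R.pre, P.Holds v.attr) → R.lhs.Valid v →
    R.rhs.Valid v ∧ R.lhs.shape.Same R.rhs.shape v.attr ∧ R.IndexBijection v ∧
    ∀ A : Acc S.toAxisSig m, R.lhs.shape.IsAccess v.attr A → ∀ σ : MapVal S.Ix m,
      (R.Related v σ ∨ (R.lhs.eval v σ A).IsScalar ∧ (R.rhs.eval v σ A).IsScalar) →
        R.lhs.eval v σ A = R.rhs.eval v σ A ∧ R.lhs.eval v σ A ≠ .err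

/-- All conditions of the rule under the general access. -/
noncomputable def conds (R : Rule S) : List (Cond S.toAxisSig) :=
  R.lhs.conds (.general _) ++ R.rhs.conds (.general _)

/-- All accesses to input tensors of the rule under the general access. -/
noncomputable def accesses (R : Rule S) : List (Σ t : S.Ten, TenAcc S t) :=
  R.lhs.accesses (.general _) ++ R.rhs.accesses (.general _)

/-- The number of distinct conditions with a non-trivial fold over an axis of class `c`; a fold is
trivial if its predicate is true on all inputs. -/
noncomputable def numConds (R : Rule S) (c : S.Cls) : ℕ :=
  {g : Cond S.toAxisSig | g ∈ R.conds ∧ ∃ (x : S.Ax c) (ρ : LEnv S.toAxisSig c), ¬ g c x ρ}.ncard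

/-- The number of distinct accesses to the input tensor `t`. -/
noncomputable def numAccesses (R : Rule S) (t : S.Ten) : ℕ :=
  {a : TenAcc S t | (⟨t, a⟩ : Σ t : S.Ten, TenAcc S t) ∈ R.accesses}.ncard

open Classical in
/-- The input tensors of the rule that have an aggregated axis of class `c`. -/
noncomputable def tensorsWith (R : Rule S) (c : S.Cls) : Finset S.Ten :=
  {t ∈ (R.accesses.map Sigma.fst).toFinset | ∃ x : S.Ax c, (⟨c, x⟩ : S.Axis) ∈ (S.shape t).dom}

noncomputable def inferBound (R : Rule S) (c : S.Cls) : ℕ :=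
  max 1 (R.numConds c + ∑ t ∈ R.tensorsWith c, (R.numAccesses t).choose 2)

end Rule

end TensorDSL

namespace TensorDSL

/-! Let a valuation at rank `i + 1` satisfy the precondition and make the left side valid. Deleting
one named axis of class `c` restricts it to rank `i`, where the rule is known to be valid. Side
conditions, shapes, index ranges and the hint are checked one named axis at a time. They therefore
pass to every restriction (`Valid.pull`, `Related.pull`), and they hold at rank `i + 1` once they
hold at all restrictions (`Valid.of_pull`, `IndexBijection.of_pull`): since `i + 1 ≥ 2`, each named
axis survives some deletion. This is the role of the `1` in the maximum. Equality of elements is not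
local, since it depends on the tensors. At a fixed access and fixed reduction indices, an element is
determined by the truth values of the conditions and by the tensor elements read
(`Expr.eval_congr`). Keep one named axis of class `c` as a witness for each false condition with a
failure there, and one for each pair of accesses to the same tensor that differ there. At most
`inferBound ≤ i` axes are kept (`exists_keep`), so one of the `i + 1` can be deleted. Its deletion
changes no truth value and merges no different accesses, so the tensors can be redefined
consistently at rank `i` (`Valuation.restrict_ten`). Both sides keep their elements, which agree by
validity at rank `i`. -/

/-! ### Restriction along maps of named axes -/

/-- Restriction of values of map variables along maps of named axes. -/
def MapVal.pull {C : Type} {V : C → Type} {m m' : C → ℕ} (val : MapVal V m)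
    (ι : ∀ c, Fin (m' c) → Fin (m c)) : MapVal V m' :=
  fun c u j => val c u (ι c j)

section Local

variable {S : Sig} {m m' : S.Cls → ℕ}

theorem Fold.Holds.pull {C : Type} {V : C → Type} {m m' : C → ℕ} {F : Fold V} {val : MapVal V m}
    (h : F.Holds val) (ι : ∀ c, Fin (m' c) → Fin (m c)) : F.Holds (val.pull ι) :=
  fun j => h (ι _ j)

/-- Preconditions only travel to restrictions. Because of disjunctions they could not be glued:
different restrictions may satisfy different disjuncts. -/
theorem Precond.Holds.pull {C : Type} {V : C → Type} {m m' : C → ℕ} {P : Precond V}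
    {val : MapVal V m} (h : P.Holds val) (ι : ∀ c, Fin (m' c) → Fin (m c)) :
    P.Holds (val.pull ι) := by
  induction P with
  | fold F => exact Fold.Holds.pull h ι
  | and P Q hP hQ => exact ⟨hP h.1, hQ h.2⟩
  | or P Q hP hQ => exact h.imp hP hQ

theorem AllAx.pull {X : Set S.Axis} {P : ∀ c : S.Cls, S.Ax c → Fin (m c) → Prop}
    (h : AllAx m X P) (ι : ∀ c, Fin (m' c) → Fin (m c)) :
    AllAx m' X fun c x j => P c x (ι c j) :=
  fun c x hx j => h c x hx (ι c j)

/-- A family of maps of named axes is jointly surjective. -/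
def JointlySurjective {C J : Type} {m m' : C → ℕ} (ι : J → ∀ c, Fin (m' c) → Fin (m c)) : Prop :=
  ∀ c (j : Fin (m c)), ∃ k j', ι k c j' = j

theorem AllAx.of_pull {J : Type} {ι : J → ∀ c, Fin (m' c) → Fin (m c)} (hι : JointlySurjective ι)
    {X : Set S.Axis} {P : ∀ c : S.Cls, S.Ax c → Fin (m c) → Prop}
    (h : ∀ k, AllAx m' X fun c x j => P c x (ι k c j)) : AllAx m X P := by
  intro c x hx j
  obtain ⟨k, j', rfl⟩ := hι c j
  exact h k c x hx j'

/-! ### Restriction and gluing of side conditions -/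

namespace Expr

/-- A side condition is a statement at each named axis, which restricts; a statement on sets of
aggregated axes, which does not see ranks; or a rank `1` requirement, which `hs` supplies. Tensor
elements play no role. -/
theorem Valid.pull {v : Valuation S m} {v' : Valuation S m'} {ι : ∀ c, Fin (m' c) → Fin (m c)}
    (hv : v'.attr = v.attr.pull ι) {τ : DType} {e : Expr S τ}
    (hs : ∀ x ∈ e.singletons, m' x.1 = 1) (h : e.Valid v) : e.Valid v' := by
  obtain ⟨attr', ten'⟩ := v'
  obtain rfl : attr' = v.attr.pull ι := hv
  induction e with
  | lit dom size data => exact hs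
  | var t => exact AllAx.pull h ι
  | const a M => exact AllAx.pull h ι
  | iota M x => exact ⟨AllAx.pull h.1 ι, h.2.1, hs x rfl⟩
  | expand e M ih => exact ⟨ih hs h.1, AllAx.pull h.2.1 ι, h.2.2⟩
  | binary o e e' ih ih' =>
    exact ⟨ih (fun x hx => hs x (.inl hx)) h.1, ih' (fun x hx => hs x (.inr hx)) h.2.1,
      h.2.2.1, AllAx.pull h.2.2.2 ι⟩
  | pad e a Sl Sh Si ih =>
    exact ⟨ih hs h.1, h.2.1, h.2.2.1, h.2.2.2.1, AllAx.pull h.2.2.2.2 ι⟩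
  | slice e Is Ie Ip ih =>
    exact ⟨ih hs h.1, h.2.1, h.2.2.1, h.2.2.2.1, AllAx.pull h.2.2.2.2 ι⟩
  | dySlice e I M ih => exact ⟨ih hs h.1, h.2.1, h.2.2.1, AllAx.pull h.2.2.2 ι⟩
  | dyupSlice e eu I ih ihu =>
    exact ⟨ih (fun x hx => hs x (.inl hx)) h.1, ihu (fun x hx => hs x (.inr hx)) h.2.1,
      h.2.2.1, h.2.2.2.1, AllAx.pull h.2.2.2.2 ι⟩
  | reduce op e I ih => exact ⟨ih hs h.1, h.2⟩
  | relabel e R ih => exact ⟨ih hs h.1, h.2⟩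
  | concat e e' x ih ih' =>
    exact ⟨ih (fun x hx => hs x (.inl (.inl hx))) h.1,
      ih' (fun x hx => hs x (.inl (.inr hx))) h.2.1, hs x (.inr rfl), h.2.2.2.1, h.2.2.2.2.1,
      AllAx.pull h.2.2.2.2.2 ι⟩
  | dot ν e e' I Xb ih ih' =>
    exact ⟨ih (fun x hx => hs x (.inl hx)) h.1, ih' (fun x hx => hs x (.inr hx)) h.2.1,
      h.2.2.1, h.2.2.2.1, AllAx.pull h.2.2.2.2 ι⟩
  | convBase ν e e' Xb Xf Xo Ip I ih ih' =>
    obtain ⟨h₁, h₂, h₃, h₄, h₅, h₆, h₇, h₈, h₉⟩ := h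
    exact ⟨ih (fun x hx => hs x (.inl hx)) h₁, ih' (fun x hx => hs x (.inr hx)) h₂,
      h₃, h₄, h₅, h₆, h₇, AllAx.pull h₈ ι, AllAx.pull h₉ ι⟩
  | select eb e e' ihb ih ih' =>
    obtain ⟨h₁, h₂, h₃, h₄, h₅⟩ := h
    exact ⟨ihb (fun x hx => hs x (.inl (.inl hx))) h₁, ih (fun x hx => hs x (.inl (.inr hx))) h₂,
      ih' (fun x hx => hs x (.inr hx)) h₃, ⟨h₄.1, AllAx.pull h₄.2 ι⟩, h₅.1, AllAx.pull h₅.2 ι⟩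
  | reverse e X ih => exact ⟨ih hs h.1, h.2⟩

theorem Valid.of_pull {J : Type} [Nonempty J] {v : Valuation S m} {v' : J → Valuation S m'}
    {ι : J → ∀ c, Fin (m' c) → Fin (m c)} (hι : JointlySurjective ι)
    (hv : ∀ k, (v' k).attr = v.attr.pull (ι k)) {τ : DType} {e : Expr S τ}
    (hs : ∀ x ∈ e.singletons, m x.1 = 1) (h : ∀ k, e.Valid (v' k)) : e.Valid v := by
  -- With the map variables literally equal to pullbacks, the side conditions at `v' k` are by
  -- definition those required by `AllAx.of_pull`.
  obtain ⟨ten', rfl⟩ : ∃ t : J → _, v' = fun k => ⟨v.attr.pull (ι k), t k⟩ :=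
    ⟨fun k => (v' k).ten, funext fun k => by rw [← hv k]⟩
  -- Conditions on sets of aggregated axes are the same at all restrictions, so they are taken from
  -- a single one.
  have k₀ : J := Classical.arbitrary J
  induction e with
  | lit dom size data => exact hs
  | var t => exact AllAx.of_pull hι h
  | const a M => exact AllAx.of_pull hι h
  | iota M x => exact ⟨AllAx.of_pull hι fun k => (h k).1, (h k₀).2.1, hs x rfl⟩
  | expand e M ih =>
    exact ⟨ih hs fun k => (h k).1, AllAx.of_pull hι fun k => (h k).2.1, (h k₀).2.2⟩
  | binary o e e' ih ih' =>
    exact ⟨ih (fun x hx => hs x (.inl hx)) fun k => (h k).1,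
      ih' (fun x hx => hs x (.inr hx)) fun k => (h k).2.1,
      (h k₀).2.2.1, AllAx.of_pull hι fun k => (h k).2.2.2⟩
  | pad e a Sl Sh Si ih =>
    exact ⟨ih hs fun k => (h k).1, (h k₀).2.1, (h k₀).2.2.1, (h k₀).2.2.2.1,
      AllAx.of_pull hι fun k => (h k).2.2.2.2⟩
  | slice e Is Ie Ip ih =>
    exact ⟨ih hs fun k => (h k).1, (h k₀).2.1, (h k₀).2.2.1, (h k₀).2.2.2.1,
      AllAx.of_pull hι fun k => (h k).2.2.2.2⟩
  | dySlice e I M ih =>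
    exact ⟨ih hs fun k => (h k).1, (h k₀).2.1, (h k₀).2.2.1,
      AllAx.of_pull hι fun k => (h k).2.2.2⟩
  | dyupSlice e eu I ih ihu =>
    exact ⟨ih (fun x hx => hs x (.inl hx)) fun k => (h k).1,
      ihu (fun x hx => hs x (.inr hx)) fun k => (h k).2.1,
      (h k₀).2.2.1, (h k₀).2.2.2.1, AllAx.of_pull hι fun k => (h k).2.2.2.2⟩
  | reduce op e I ih => exact ⟨ih hs fun k => (h k).1, (h k₀).2⟩
  | relabel e R ih => exact ⟨ih hs fun k => (h k).1, (h k₀).2⟩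
  | concat e e' x ih ih' =>
    exact ⟨ih (fun x hx => hs x (.inl (.inl hx))) fun k => (h k).1,
      ih' (fun x hx => hs x (.inl (.inr hx))) fun k => (h k).2.1, hs x (.inr rfl),
      (h k₀).2.2.2.1, (h k₀).2.2.2.2.1, AllAx.of_pull hι fun k => (h k).2.2.2.2.2⟩
  | dot ν e e' I Xb ih ih' =>
    exact ⟨ih (fun x hx => hs x (.inl hx)) fun k => (h k).1,
      ih' (fun x hx => hs x (.inr hx)) fun k => (h k).2.1,
      (h k₀).2.2.1, (h k₀).2.2.2.1, AllAx.of_pull hι fun k => (h k).2.2.2.2⟩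
  | convBase ν e e' Xb Xf Xo Ip I ih ih' =>
    obtain ⟨-, -, h₃, h₄, h₅, h₆, h₇, -, -⟩ := h k₀
    exact ⟨ih (fun x hx => hs x (.inl hx)) fun k => (h k).1,
      ih' (fun x hx => hs x (.inr hx)) fun k => (h k).2.1,
      h₃, h₄, h₅, h₆, h₇, AllAx.of_pull hι fun k => (h k).2.2.2.2.2.2.2.1,
      AllAx.of_pull hι fun k => (h k).2.2.2.2.2.2.2.2⟩
  | select eb e e' ihb ih ih' =>
    exact ⟨ihb (fun x hx => hs x (.inl (.inl hx))) fun k => (h k).1,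
      ih (fun x hx => hs x (.inl (.inr hx))) fun k => (h k).2.1,
      ih' (fun x hx => hs x (.inr hx)) fun k => (h k).2.2.1,
      ⟨(h k₀).2.2.2.1.1, AllAx.of_pull hι fun k => (h k).2.2.2.1.2⟩,
      (h k₀).2.2.2.2.1, AllAx.of_pull hι fun k => (h k).2.2.2.2.2⟩
  | reverse e X ih => exact ⟨ih hs fun k => (h k).1, (h k₀).2⟩

theorem InRange.pull {v : Valuation S m} {v' : Valuation S m'} {ι : ∀ c, Fin (m' c) → Fin (m c)}
    (hv : v'.attr = v.attr.pull ι) {τ : DType} {e : Expr S τ} {σ : MapVal S.Ix m}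
    (h : e.InRange v σ) : e.InRange v' (σ.pull ι) := by
  intro c i b hb j
  rw [hv]
  exact h c i b hb (ι c j)

theorem SameIdx.pull {τ : DType} {e : Expr S τ} {σ σ' : MapVal S.Ix m} (h : e.SameIdx σ σ')
    (ι : ∀ c, Fin (m' c) → Fin (m c)) : e.SameIdx (σ.pull ι) (σ'.pull ι) :=
  fun c i b hb => funext fun j => congrFun (h c i b hb) (ι c j)

theorem SameIdx.of_pull {J : Type} {ι : J → ∀ c, Fin (m' c) → Fin (m c)}
    (hι : JointlySurjective ι) {τ : DType} {e : Expr S τ} {σ σ' : MapVal S.Ix m}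
    (h : ∀ k, e.SameIdx (σ.pull (ι k)) (σ'.pull (ι k))) : e.SameIdx σ σ' := by
  intro c i b hb
  funext j
  obtain ⟨k, j', rfl⟩ := hι c j
  exact congrFun (h k c i b hb) j'

end Expr

/-! ### Restriction and gluing of reduction indices -/

namespace Rule

theorem Related.pull {R : Rule S} {v : Valuation S m} {v' : Valuation S m'}
    {ι : ∀ c, Fin (m' c) → Fin (m c)} (hv : v'.attr = v.attr.pull ι) {σ : MapVal S.Ix m}
    (h : R.Related v σ) : R.Related v' (σ.pull ι) := by
  refine ⟨h.1.pull hv, h.2.1.pull hv, fun F hF j => ?_⟩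
  convert h.2.2 F hF (ι _ j) using 5 with k u
  rw [hv]
  cases u <;> rfl

/-- Related reduction indices at all restrictions can be glued. -/
theorem Related.glue {J : Type} {R : Rule S} {v : Valuation S m} {v' : J → Valuation S m'}
    {ι : J → ∀ c, Fin (m' c) → Fin (m c)} (hι : JointlySurjective ι)
    (hv : ∀ k, (v' k).attr = v.attr.pull (ι k)) {σ : J → MapVal S.Ix m'}
    (h : ∀ k, R.Related (v' k) (σ k)) :
    ∃ σ' : MapVal S.Ix m, R.Related v σ' ∧
      ∀ c (j : Fin (m c)), ∃ k j', ι k c j' = j ∧ ∀ i, σ' c i j = σ k c i j' := by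
  -- For each named axis, choose one restriction that contains it and copy the indices from there.
  -- The restrictions need not agree on overlaps, because ranges and hint constrain each named axis
  -- separately.
  choose κ p hp using hι
  have hattr : ∀ c u (j : Fin (m c)), v.attr c u j = (v' (κ c j)).attr c u (p c j) := by
    intro c u j
    rw [hv]
    simp only [MapVal.pull, hp]
  refine ⟨fun c i j => σ (κ c j) c i (p c j), ⟨?_, ?_, ?_⟩, fun c j => ⟨_, _, hp c j, fun _ => rfl⟩⟩
  · intro c i b hb j
    simp only [hattr]
    exact (h (κ c j)).1 c i b hb (p c j)
  · intro c i b hb j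
    simp only [hattr]
    exact (h (κ c j)).2.1 c i b hb (p c j)
  · intro F hF j
    convert (h (κ _ j)).2.2 F hF (p _ j) using 5 with k u
    cases u with
    | inl u => exact hattr _ _ _
    | inr u => rfl

theorem IndexBijection.of_pull {J : Type} {R : Rule S} {v : Valuation S m}
    {v' : J → Valuation S m'} {ι : J → ∀ c, Fin (m' c) → Fin (m c)} (hι : JointlySurjective ι)
    (hv : ∀ k, (v' k).attr = v.attr.pull (ι k)) (h : ∀ k, R.IndexBijection (v' k)) :
    R.IndexBijection v := by
  refine ⟨fun σ hσ => ?_, fun σ hσ => ?_, fun σ σ' hσ hσ' => ⟨fun hs => ?_, fun hs => ?_⟩⟩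
  · choose s hs hs' using fun k => (h k).1 _ (hσ.pull (hv k))
    obtain ⟨σ', h₁, h₂⟩ := Related.glue hι hv hs
    refine ⟨σ', h₁, fun c i b hb => funext fun j => ?_⟩
    obtain ⟨k, j', rfl, h₃⟩ := h₂ c j
    rw [h₃]
    exact congrFun (hs' k c i b hb) j'
  · choose s hs hs' using fun k => (h k).2.1 _ (hσ.pull (hv k))
    obtain ⟨σ', h₁, h₂⟩ := Related.glue hι hv hs
    refine ⟨σ', h₁, fun c i b hb => funext fun j => ?_⟩
    obtain ⟨k, j', rfl, h₃⟩ := h₂ c j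
    rw [h₃]
    exact congrFun (hs' k c i b hb) j'
  · exact .of_pull hι fun k =>
      ((h k).2.2 _ _ (hσ.pull (hv k)) (hσ'.pull (hv k))).1 (hs.pull _)
  · exact .of_pull hι fun k =>
      ((h k).2.2 _ _ (hσ.pull (hv k)) (hσ'.pull (hv k))).2 (hs.pull _)

end Rule

end Local

/-! ### Soundness of symbolic evaluation -/

section Symbolic

variable {S : Sig} {m m' : S.Cls → ℕ}

/-- Values of all symbolic maps at all named axes. -/
abbrev Env (S : AxisSig) (m : S.Cls → ℕ) : Type := ∀ c, Fin (m c) → LEnv S c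

/-- The values of the map variables, the general access and the reduction indices. -/
def Env.of {S : AxisSig} {m : S.Cls → ℕ} (attr : MapVal S.Attr m) (A : Acc S m)
    (σ : MapVal S.Ix m) : Env S m
  | c, j, .attr u => attr c u j
  | c, j, .acc x => A c x j
  | c, j, .si i => σ c i j

def Env.attr {S : AxisSig} {m : S.Cls → ℕ} (E : Env S m) : MapVal S.Attr m :=
  fun c u j => E c j (.attr u)

def Env.si {S : AxisSig} {m : S.Cls → ℕ} (E : Env S m) : MapVal S.Ix m :=
  fun c i j => E c j (.si i)

/-- The access that a symbolic access stands for. -/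
def SymAcc.inst {S : AxisSig} {m : S.Cls → ℕ} (a : SymAcc S) (E : Env S m) : Acc S m :=
  fun c x j => a c x (E c j)

def TenAcc.inst {t : S.Ten} (a : TenAcc S t) (E : Env S.toAxisSig m) (c : S.Cls) (x : S.Ax c)
    (hx : (⟨c, x⟩ : S.Axis) ∈ (S.shape t).dom) (j : Fin (m c)) : ℤ :=
  a c x hx (E c j)

def Cond.Holds {S : AxisSig} {m : S.Cls → ℕ} (g : Cond S) (E : Env S m) : Prop :=
  ∀ (c : S.Cls) (x : S.Ax c) (j : Fin (m c)), g c x (E c j)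

/-- Two environments agree at the only named axis of each singleton axis in `X`. -/
def AgreeOn {S : AxisSig} {m m' : S.Cls → ℕ} (X : Set S.Axis) (E : Env S m) (E' : Env S m') :
    Prop :=
  ∀ x ∈ X, ∃ (h : 0 < m x.1) (h' : 0 < m' x.1), E x.1 ⟨0, h⟩ = E' x.1 ⟨0, h'⟩

theorem AgreeOn.mono {S : AxisSig} {m m' : S.Cls → ℕ} {X Y : Set S.Axis} {E : Env S m}
    {E' : Env S m'} (h : AgreeOn Y E E') (hXY : X ⊆ Y) : AgreeOn X E E' :=
  fun x hx => h x (hXY hx)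

theorem SymAcc.single_inst {S : AxisSig} {m m' : S.Cls → ℕ} {X : Set S.Axis} {E : Env S m}
    {E' : Env S m'} (h : AgreeOn X E E') (a : SymAcc S) :
    (a.inst E).single X = (a.inst E').single X := by
  funext c x
  by_cases hx : (⟨c, x⟩ : S.Axis) ∈ X
  · obtain ⟨h₁, h₂, h₃⟩ := h _ hx
    simp only [Acc.single, hx, h₁, h₂, true_and, dite_true, SymAcc.inst, h₃]
  · simp only [Acc.single, hx, false_and, dite_false]

/-- The value of an expression is determined by the truth values of the conditions, by the tensor
elements read, and by the singleton axes. -/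
theorem Expr.eval_congr {E : Env S.toAxisSig m} {E' : Env S.toAxisSig m'}
    {v : Valuation S m} {v' : Valuation S m'} (hv : v.attr = E.attr) (hv' : v'.attr = E'.attr)
    {τ : DType} (e : Expr S τ) (a : SymAcc S.toAxisSig)
    (hc : ∀ g ∈ e.conds a, Cond.Holds g E ↔ Cond.Holds g E')
    (ha : ∀ p ∈ e.accesses a, v.ten p.1 (p.2.inst E) = v'.ten p.1 (p.2.inst E'))
    (hs : AgreeOn e.singletons E E') :
    e.eval v E.si (a.inst E) = e.eval v' E'.si (a.inst E') := by
  classical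
  revert hs
  obtain ⟨attr, ten⟩ := v
  obtain rfl : attr = E.attr := hv
  obtain ⟨attr', ten'⟩ := v'
  obtain rfl : attr' = E'.attr := hv'
  intro hs
  -- The operands are read at transformed accesses, so `a` must vary. Each symbolic transformer
  -- instantiates by definition to the access used in `eval`.
  induction e generalizing a with
  | lit dom size data =>
    exact congrArg (fun s => Elem.val (data s)) (SymAcc.single_inst hs a)
  | var t => exact congrArg Elem.val (ha _ (List.mem_singleton_self _))
  | const a M => rfl
  | iota M x =>
    exact congrArg (fun s : ∀ c, S.Ax c → ℤ => Elem.val (s x.1 x.2)) (SymAcc.single_inst hs a)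
  | expand e M ih => exact ih a hc ha hs
  | binary o e e' ih ih' =>
    exact congrArg₂ o.lift
      (ih a (fun g hg => hc g (List.mem_append_left _ hg))
        (fun p hp => ha p (List.mem_append_left _ hp)) (hs.mono Set.subset_union_left))
      (ih' a (fun g hg => hc g (List.mem_append_right _ hg))
        (fun p hp => ha p (List.mem_append_right _ hp)) (hs.mono Set.subset_union_right))
  | pad e z Sl Sh Si ih =>
    refine if_congr ?_ (ih (padSym Sl Si a) (fun g hg => hc g (List.mem_cons_of_mem _ hg)) ha hs) rfl
    -- The branch test is this condition up to order of quantifiers: `AllAx` takes the membership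
    -- before the named axis, `Cond.Holds` after it.
    have := hc _ List.mem_cons_self
    exact ⟨fun h c x hx j => this.1 (fun c x j hx => h c x hx j) c x j hx,
      fun h c x hx j => this.2 (fun c x j hx => h c x hx j) c x j hx⟩
  | slice e Is Ie Ip ih => exact ih (sliceSym Is Ip a) hc ha hs
  | dySlice e I M ih => exact ih (addSym I a) hc ha hs
  | dyupSlice e eu I ih ihu =>
    refine if_congr ?_
      (ihu (subSym I a) (fun g hg => hc g (List.mem_cons_of_mem _ (List.mem_append_left _ hg)))
        (fun p hp => ha p (List.mem_append_left _ hp)) (hs.mono Set.subset_union_right))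
      (ih a (fun g hg => hc g (List.mem_cons_of_mem _ (List.mem_append_right _ hg)))
        (fun p hp => ha p (List.mem_append_right _ hp)) (hs.mono Set.subset_union_left))
    have := hc _ List.mem_cons_self
    exact ⟨fun h c x hx j => this.1 (fun c x j hx => h c x hx j) c x j hx,
      fun h c x hx j => this.2 (fun c x j hx => h c x hx j) c x j hx⟩
  | reduce op e I ih => exact congrArg (Elem.reduce op) (ih (a.subst I) hc ha hs)
  | relabel e R ih => exact ih (fun c x => a c (R c x)) hc ha hs
  | concat e e' x₀ ih ih' =>
    refine if_congr ?_
      (ih' (concatSym e.shape x₀ a)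
        (fun g hg => hc g (List.mem_cons_of_mem _ (List.mem_append_left _ hg)))
        (fun p hp => ha p (List.mem_append_left _ hp))
        (hs.mono fun _ hx => .inl (.inr hx)))
      (ih a (fun g hg => hc g (List.mem_cons_of_mem _ (List.mem_append_right _ hg)))
        (fun p hp => ha p (List.mem_append_right _ hp))
        (hs.mono fun _ hx => .inl (.inl hx)))
    have := hc _ List.mem_cons_self
    exact ⟨fun h c x hx j => this.1 (fun c x j hx => h c x hx j) c x j hx,
      fun h c x hx j => this.2 (fun c x j hx => h c x hx j) c x j hx⟩
  | dot ν e e' I Xb ih ih' =>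
    exact congrArg₂ (fun y z => (Elem.mul ν y z).reduce ν.add)
      (ih (a.subst I) (fun g hg => hc g (List.mem_append_left _ hg))
        (fun p hp => ha p (List.mem_append_left _ hp)) (hs.mono Set.subset_union_left))
      (ih' (a.subst I) (fun g hg => hc g (List.mem_append_right _ hg))
        (fun p hp => ha p (List.mem_append_right _ hp)) (hs.mono Set.subset_union_right))
  | convBase ν e e' Xb Xf Xo Ip I ih ih' =>
    exact congrArg₂ (fun y z => (Elem.mul ν y z).reduce ν.add)
      (ih (convSym (spatial e.shape.dom Xb Xf) Ip I a)
        (fun g hg => hc g (List.mem_append_left _ hg))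
        (fun p hp => ha p (List.mem_append_left _ hp)) (hs.mono Set.subset_union_left))
      (ih' (a.subst I) (fun g hg => hc g (List.mem_append_right _ hg))
        (fun p hp => ha p (List.mem_append_right _ hp)) (hs.mono Set.subset_union_right))
  | select eb e e' ihb ih ih' =>
    have h₀ := ihb a
      (fun g hg => hc g (List.mem_append_left _ (List.mem_append_left _ hg)))
      (fun p hp => ha p (List.mem_append_left _ (List.mem_append_left _ hp)))
      (hs.mono fun _ hx => .inl (.inl hx))
    have h₁ := ih a
      (fun g hg => hc g (List.mem_append_left _ (List.mem_append_right _ hg)))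
      (fun p hp => ha p (List.mem_append_left _ (List.mem_append_right _ hp)))
      (hs.mono fun _ hx => .inl (.inr hx))
    have h₂ := ih' a (fun g hg => hc g (List.mem_append_right _ hg))
      (fun p hp => ha p (List.mem_append_right _ hp)) (hs.mono Set.subset_union_right)
    simp only [Expr.eval, h₀, h₁, h₂]
  | reverse e X ih => exact ih (reverseSym e.shape X a) hc ha hs

end Symbolic

/-! ### Deleting a named axis -/

section Deletion

/-- The named axes of class `c` other than `j₀`, and all named axes of the other classes. -/
theorem exists_deletion {C : Type} [DecidableEq C] (m : C → ℕ) (c : C) (n : ℕ)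
    (j₀ : Fin (Function.update m c (n + 1) c)) :
    ∃ ι : ∀ c', Fin (Function.update m c n c') → Fin (Function.update m c (n + 1) c'),
      (∀ j, j ≠ j₀ → ∃ j', ι c j' = j) ∧
      ∀ c', c' ≠ c → Function.Surjective (ι c') ∧ ∀ j', (ι c' j' : ℕ) = j' := by
  have h₀ : Function.update m c n c = n := by simp
  have h₁ : n + 1 = Function.update m c (n + 1) c := by simp
  have h₂ : ∀ c', c' ≠ c → Function.update m c n c' = Function.update m c (n + 1) c' := by
    intro c' h; simp [h]
  -- In class `c`, `succAbove` skips `j₀`. In the other classes the map preserves the number of each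
  -- axis, so the only axis of a singleton is still number `0`.
  refine ⟨fun c' => if h : c' = c then fun j => Fin.cast (by rw [h, ← h₁])
    ((Fin.cast h₁.symm j₀).succAbove (Fin.cast (by rw [h, h₀]) j)) else Fin.cast (h₂ c' h),
    fun j hj => ?_, fun c' hc => ?_⟩
  · have : Fin.cast h₁.symm j ≠ Fin.cast h₁.symm j₀ := fun h => hj (Fin.cast_injective _ h)
    obtain ⟨k, hk⟩ := Fin.exists_succAbove_eq this
    refine ⟨Fin.cast h₀.symm k, ?_⟩
    simp [hk]
  · simp only [hc, dite_false]
    exact ⟨fun j => ⟨Fin.cast (h₂ c' hc).symm j, by simp⟩, fun j => rfl⟩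

variable {S : Sig}

namespace Rule

/-- Deleting any named axis of class `c` outside a set of at most `inferBound` named axes keeps all
false conditions false and all different accesses to the same tensor different. -/
theorem exists_keep (R : Rule S) (c : S.Cls) {m : S.Cls → ℕ} (E : Env S.toAxisSig m)
    [Nonempty (Fin (m c))] :
    ∃ K : Finset (Fin (m c)), K.card ≤ R.inferBound c ∧
      (∀ g ∈ R.conds, (∃ x j, ¬ g c x (E c j)) → ∃ x, ∃ j ∈ K, ¬ g c x (E c j)) ∧
      ∀ t (a b : TenAcc S t), ⟨t, a⟩ ∈ R.accesses → ⟨t, b⟩ ∈ R.accesses →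
        (∃ x hx j, a c x hx (E c j) ≠ b c x hx (E c j)) →
        ∃ x hx, ∃ j ∈ K, a c x hx (E c j) ≠ b c x hx (E c j) := by
  classical
  let G : Set (Cond S.toAxisSig) :=
    {g | g ∈ R.conds ∧ ∃ (x : S.Ax c) (ρ : LEnv S.toAxisSig c), ¬ g c x ρ}
  have hG : G.Finite := (List.finite_toSet R.conds).subset fun g hg => hg.1
  let T (t : S.Ten) : Set (TenAcc S t) := {a | (⟨t, a⟩ : Σ t : S.Ten, TenAcc S t) ∈ R.accesses}
  have hT (t : S.Ten) : (T t).Finite :=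
    (List.finite_toSet R.accesses).preimage fun a _ b _ h => eq_of_heq (Sigma.mk.inj h).2
  -- Stated as an implication so that the witness is a total function of `g`; conditions without a
  -- failure get an arbitrary axis.
  have hf (g : Cond S.toAxisSig) : ∃ j, (∃ x j, ¬ g c x (E c j)) → ∃ x, ¬ g c x (E c j) := by
    by_cases h : ∃ x j, ¬ g c x (E c j)
    · obtain ⟨x, j, h⟩ := h
      exact ⟨j, fun _ => ⟨x, h⟩⟩
    · exact ⟨Classical.arbitrary _, fun h' => absurd h' h⟩
  choose f hf using hf
  -- The witness depends on a set of accesses and not on an ordered pair, so each two-element set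
  -- costs one axis and the count is a binomial coefficient.
  have hd (t : S.Ten) (s : Finset (TenAcc S t)) : ∃ j,
      (∃ a ∈ s, ∃ b ∈ s, ∃ x hx j, a c x hx (E c j) ≠ b c x hx (E c j)) →
        ∃ a ∈ s, ∃ b ∈ s, ∃ x hx, a c x hx (E c j) ≠ b c x hx (E c j) := by
    by_cases h : ∃ a ∈ s, ∃ b ∈ s, ∃ x hx j, a c x hx (E c j) ≠ b c x hx (E c j)
    · obtain ⟨a, ha, b, hb, x, hx, j, h⟩ := h
      exact ⟨j, fun _ => ⟨a, ha, b, hb, x, hx, h⟩⟩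
    · exact ⟨Classical.arbitrary _, fun h' => absurd h' h⟩
  choose d hd using hd
  refine ⟨hG.toFinset.image f ∪
    (R.tensorsWith c).biUnion fun t => ((hT t).toFinset.powersetCard 2).image (d t), ?_, ?_, ?_⟩
  · refine (Finset.card_union_le _ _).trans (le_trans ?_ (le_max_right _ _))
    refine add_le_add (Finset.card_image_le.trans ?_) (Finset.card_biUnion_le.trans ?_)
    · exact (Set.ncard_eq_toFinset_card G hG).ge
    · refine Finset.sum_le_sum fun t _ => Finset.card_image_le.trans ?_
      rw [Finset.card_powersetCard, numAccesses, Set.ncard_eq_toFinset_card _ (hT t)]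
  · intro g hg h
    obtain ⟨x, hx⟩ := hf g h
    refine ⟨x, f g, Finset.mem_union_left _ (Finset.mem_image_of_mem f ?_), hx⟩
    -- A condition that fails somewhere in class `c` is non-trivial there, hence counted by
    -- `numConds`.
    exact hG.mem_toFinset.2 ⟨hg, x, _, hx⟩
  · intro t a b ha hb h
    have hab : a ≠ b := by
      rintro rfl
      obtain ⟨x, hx, j, h⟩ := h
      exact h rfl
    obtain ⟨x₀, hx₀, j₀, h₀⟩ := h
    -- The axis `x₀` at which the accesses differ shows that `t` has an aggregated axis of class
    -- `c`, so its pairs are counted.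
    have hj : d t {a, b} ∈ (R.tensorsWith c).biUnion fun t =>
        ((hT t).toFinset.powersetCard 2).image (d t) := by
      refine Finset.mem_biUnion.2 ⟨t, ?_, Finset.mem_image_of_mem _ ?_⟩
      · simp only [tensorsWith, Finset.mem_filter, List.mem_toFinset]
        exact ⟨List.mem_map.2 ⟨_, ha, rfl⟩, x₀, hx₀⟩
      · refine Finset.mem_powersetCard.2 ⟨fun y hy => ?_, Finset.card_pair hab⟩
        rw [Set.Finite.mem_toFinset]
        rcases Finset.mem_insert.1 hy with rfl | hy
        · exact ha
        · rw [Finset.mem_singleton.1 hy]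
          exact hb
    obtain ⟨a', ha', b', hb', x, hx, hne⟩ :=
      hd t {a, b} ⟨a, by simp, b, by simp, x₀, hx₀, j₀, h₀⟩
    refine ⟨x, hx, _, Finset.mem_union_right _ hj, ?_⟩
    simp only [Finset.mem_insert, Finset.mem_singleton] at ha' hb'
    rcases ha' with rfl | rfl <;> rcases hb' with rfl | rfl
    · exact absurd rfl hne
    · exact hne
    · exact hne.symm
    · exact absurd rfl hne

end Rule

open Classical in
/-- The restriction of a valuation along maps of named axes: the tensors have at the restrictions
of the accesses in `L` the elements that they had at these accesses. -/
noncomputable def Valuation.restrict {m m' : S.Cls → ℕ} (v : Valuation S m)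
    (E : Env S.toAxisSig m) (ι : ∀ c, Fin (m' c) → Fin (m c)) (L : List (Σ t : S.Ten, TenAcc S t)) :
    Valuation S m' where
  attr := v.attr.pull ι
  ten t B :=
    if h : ∃ a : TenAcc S t, ⟨t, a⟩ ∈ L ∧ a.inst (fun c j => E c (ι c j)) = B then
      v.ten t (h.choose.inst E)
    -- Filler for accesses that come from no member of `L`; its value is irrelevant.
    else v.ten t fun _ _ _ _ => 0

/-- By `hL`, all members of `L` with the same restriction were already equal before it, so the
choice made in `restrict` does not affect the element. -/
theorem Valuation.restrict_ten {m m' : S.Cls → ℕ} (v : Valuation S m) (E : Env S.toAxisSig m)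
    (ι : ∀ c, Fin (m' c) → Fin (m c)) {L : List (Σ t : S.Ten, TenAcc S t)}
    (hL : ∀ t (a b : TenAcc S t), ⟨t, a⟩ ∈ L → ⟨t, b⟩ ∈ L →
      a.inst (fun c j => E c (ι c j)) = b.inst (fun c j => E c (ι c j)) → a.inst E = b.inst E)
    {p : Σ t : S.Ten, TenAcc S t} (hp : p ∈ L) :
    v.ten p.1 (p.2.inst E) =
      (v.restrict E ι L).ten p.1 (p.2.inst fun c j => E c (ι c j)) := by
  have h : ∃ a : TenAcc S p.1, ⟨p.1, a⟩ ∈ L ∧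
      a.inst (fun c j => E c (ι c j)) = p.2.inst fun c j => E c (ι c j) := ⟨p.2, hp, rfl⟩
  simp only [Valuation.restrict, h, dite_true]
  rw [hL _ _ _ h.choose_spec.1 hp h.choose_spec.2]

end Deletion

end TensorDSL

/-! ### The step from rank `i` to rank `i + 1` -/

open TensorDSL in
theorem mainTheorem2 (S : TensorDSL.Sig) [DecidableEq S.Cls] (R : TensorDSL.Rule S) (c : S.Cls)
    (m : S.Cls → ℕ) (i : ℕ) (hi : R.inferBound c ≤ i)
    (hm : R.Admissible (Function.update m c (i + 1))) :
    R.ValidAt (Function.update m c i) → R.ValidAt (Function.update m c (i + 1)) := by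
  intro hvalid v hpre hlhs
  have hi₁ : 1 ≤ i := (le_max_left _ _).trans hi
  -- Singletons have rank `1` while class `c` has rank `i + 1 ≥ 2`, so no singleton axis lies in
  -- class `c`.
  have hne : ∀ x ∈ R.lhs.singletons ∪ R.rhs.singletons, x.1 ≠ c := by
    intro x hx h
    have := hm x hx
    rw [h, Function.update_self] at this
    omega
  have hm' : R.Admissible (Function.update m c i) := by
    intro x hx
    have := hm x hx
    rwa [Function.update_of_ne (hne x hx)] at this ⊢
  have hcard : Function.update m c (i + 1) c = i + 1 := Function.update_self ..
  have : Nontrivial (Fin (Function.update m c (i + 1) c)) := by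
    rw [hcard]
    exact Fin.nontrivial_iff_two_le.2 (by omega)
  choose ι hι₁ hι₂ using exists_deletion m c i
  have hι : JointlySurjective ι := by
    intro c' j
    by_cases h : c' = c
    · subst h
      -- The axis `j` survives the deletion of any other axis `k`.
      obtain ⟨k, hk⟩ := exists_ne j
      obtain ⟨j', hj'⟩ := hι₁ k j hk.symm
      exact ⟨k, j', hj'⟩
    · obtain ⟨j', hj'⟩ := (hι₂ (Classical.arbitrary _) c' h).1 j
      exact ⟨_, j', hj'⟩
  -- Only the map variables of `w` are prescribed; its tensors remain free and are chosen later to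
  -- suit the access.
  have hpull (w : Valuation S (Function.update m c i)) (k)
      (hw : w.attr = v.attr.pull (ι k)) := by
    refine hvalid w (fun P hP => ?_)
      (hlhs.pull hw fun x hx => hm' x (.inl hx))
    rw [hw]
    exact (hpre P hP).pull _
  -- Everything except equality of elements depends on the map variables alone, so arbitrary tensors
  -- suffice here.
  let w₀ (k) : Valuation S (Function.update m c i) :=
    ⟨v.attr.pull (ι k), fun t _ => v.ten t fun _ _ _ _ => 0⟩
  have hw₀ (k) := hpull (w₀ k) k rfl
  refine ⟨Expr.Valid.of_pull (v' := w₀) hι (fun _ => rfl) (fun x hx => hm x (.inr hx))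
      fun k => (hw₀ k).1,
    ⟨(hw₀ (Classical.arbitrary _)).2.1.1, AllAx.of_pull hι fun k => (hw₀ k).2.1.2⟩,
    .of_pull (v' := w₀) hι (fun _ => rfl) fun k => (hw₀ k).2.2.1, fun A hA σ hσ => ?_⟩
  let E : Env S.toAxisSig _ := Env.of v.attr A σ
  obtain ⟨K, hK, hKc, hKa⟩ := R.exists_keep c E
  obtain ⟨k, hk⟩ : ∃ k, k ∉ K := by
    by_contra! h
    rw [Finset.eq_univ_of_forall h, Finset.card_univ, Fintype.card_fin, hcard] at hK
    omega
  let E' : Env S.toAxisSig (Function.update m c i) := fun c' j => E c' (ι k c' j)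
  let w := v.restrict E (ι k) R.accesses
  have hcond : ∀ g ∈ R.conds, Cond.Holds g E ↔ Cond.Holds g E' := by
    refine fun g hg => ⟨fun h c' x j => h c' x _, fun h c' x j => ?_⟩
    by_cases hc : c' = c
    · subst hc
      by_contra hj
      -- The failure at `j` may be lost with the deleted axis, but the one at the kept axis `l ≠ k`
      -- is not.
      obtain ⟨y, l, hl, hy⟩ := hKc g hg ⟨x, j, hj⟩
      obtain ⟨l', rfl⟩ := hι₁ k l fun h => hk (h ▸ hl)
      exact hy (h _ y l')
    · obtain ⟨j', rfl⟩ := (hι₂ k c' hc).1 j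
      exact h c' x j'
  have hacc : ∀ t (a b : TenAcc S t), ⟨t, a⟩ ∈ R.accesses → ⟨t, b⟩ ∈ R.accesses →
      a.inst E' = b.inst E' → a.inst E = b.inst E := by
    intro t a b ha hb h
    have h' : ∀ c' x hx j, a c' x hx (E c' (ι k c' j)) = b c' x hx (E c' (ι k c' j)) :=
      fun c' x hx j => congrFun (congrFun (congrFun (congrFun h c') x) hx) j
    funext c' x hx j
    by_cases hc : c' = c
    · subst hc
      by_contra hj
      obtain ⟨y, hy, l, hl, hne⟩ := hKa t a b ha hb ⟨x, hx, j, hj⟩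
      obtain ⟨l', rfl⟩ := hι₁ k l fun h => hk (h ▸ hl)
      exact hne (h' _ y hy l')
    · obtain ⟨j', rfl⟩ := (hι₂ k c' hc).1 j
      exact h' c' x hx j'
  have hsing : AgreeOn (R.lhs.singletons ∪ R.rhs.singletons) E E' := by
    intro x hx
    have h₁ := hm x hx
    have h₂ := hm' x hx
    refine ⟨by omega, by omega, congrArg (E x.1) (Fin.ext ?_)⟩
    exact ((hι₂ k x.1 (hne x hx)).2 ⟨0, by omega⟩).symm
  have hten {p} (hp : p ∈ R.accesses) := v.restrict_ten E (ι k) hacc hp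
  have hl : R.lhs.eval v σ A = R.lhs.eval w (σ.pull (ι k)) (A.pull (ι k)) :=
    Expr.eval_congr (E := E) (E' := E') rfl rfl R.lhs (.general _)
      (fun g hg => hcond g (List.mem_append_left _ hg))
      (fun p hp => hten (List.mem_append_left _ hp)) (hsing.mono Set.subset_union_left)
  have hr : R.rhs.eval v σ A = R.rhs.eval w (σ.pull (ι k)) (A.pull (ι k)) :=
    Expr.eval_congr (E := E) (E' := E') rfl rfl R.rhs (.general _)
      (fun g hg => hcond g (List.mem_append_right _ hg))
      (fun p hp => hten (List.mem_append_right _ hp)) (hsing.mono Set.subset_union_right)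
  -- The scalar alternative of `hσ` moves to rank `i` by this rewriting, the related alternative by
  -- `Related.pull`.
  rw [hl, hr] at hσ ⊢
  exact (hpull w k rfl).2.2.2 _ (AllAx.pull hA _) _ (hσ.imp_left fun h =>
    h.pull (v' := w) (ι := ι k) rfl)
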